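/- For a finite simple graph $G$ let $\chi(G)$ be its chromatic number, $\Delta(G)$ its maximum degree, and $\mathcal{H}(G)$ the subgraph of $G$ induced on the vertices of degree at least $\chi(G)$. Call $G$ critical if $\chi(G - v) < \chi(G)$ for every vertex $v$ of $G$. Then $K_{\chi(G)}$ is the only critical graph $G$ with $\chi(G) \geq \Delta(G) \geq 6$ such that $\mathcal{H}(G)$ is independent (that is, has no edges). Explicitly: if $G$ is a finite simple graph with $\Delta(G) \geq 6$, then $G$ is isomorphic to the complete graph $K_{\chi(G)}$ if and only if $G$ is critical, $\chi(G) \geq \Delta(G)$, and $\mathcal{H}(G)$ has no edges. -/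

import Mathlib

namespace SimpleGraph

/-- A graph is (vertex-)critical if deleting any vertex lowers the chromatic number.
Every graph all of whose proper subgraphs have smaller chromatic number is critical in
this sense. -/
def IsCritical {V : Type*} (G : SimpleGraph V) : Prop :=
  ∀ v : V, (G.induce ({v}ᶜ : Set V)).chromaticNumber < G.chromaticNumber

/-- The set of vertices of degree at least the chromatic number. -/
def highVertices {V : Type*} (G : SimpleGraph V) [G.LocallyFinite] : Set V :=
  {v : V | G.chromaticNumber ≤ (G.degree v : ℕ∞)}

/-- The subgraph of `G` induced on the vertices of degree at least the chromatic number. -/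
def highSubgraph {V : Type*} (G : SimpleGraph V) [G.LocallyFinite] :
    SimpleGraph G.highVertices :=
  G.induce G.highVertices

end SimpleGraph

/-! Put m = χ(G) - 1 ≥ 5. Then G is not m-colorable, every G - x is, all degrees are at most m + 1,
and the vertices of degree m + 1 are independent; call the others low. Write m = r + s and divide an
m-coloring of some G - x into an r-colored part P and an s-colored part Q with as few edges inside
the parts as possible. If x has only r neighbours in P, it can trade places with any of them at no
cost. Iterating, the component of x in P + x is r-regular and each of its vertices can be the
uncolored one (`IsOptSplit.of_reachable`).

Such a component contains two adjacent low vertices, since otherwise low/high would 2-color it.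
Uncolor one of them, continue in Q, then in P, and so on. Either a step produces three closed twins
of degree m (`IsOptSplit.closed_twins`), or each component left behind is blocked from then on
(`IsStage.exists_next`), which cannot continue in a finite graph. Recoloring around the twins makes
their closed neighbourhood a clique on m + 1 vertices (`isClique_of_closed_twins`), and criticality
leaves no room for further vertices. -/

namespace SimpleGraph

/-! ### Paths and degrees inside vertex sets -/

variable {V : Type*}

/-- The spanning subgraph of `G` formed by the edges inside `S`. -/
def within (G : SimpleGraph V) (S : Finset V) : SimpleGraph V where
  Adj a b := G.Adj a b ∧ a ∈ S ∧ b ∈ S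
  symm := ⟨fun _ _ h => ⟨h.1.symm, h.2.2, h.2.1⟩⟩
  loopless := ⟨fun _ h => h.1.ne rfl⟩

theorem within_mono (G : SimpleGraph V) {S T : Finset V} (h : S ⊆ T) :
    G.within S ≤ G.within T := fun _ _ hab => ⟨hab.1, h hab.2.1, h hab.2.2⟩

theorem Reachable.propagate {H : SimpleGraph V} {a b : V} (h : H.Reachable a b) {p : V → Prop}
    (ha : p a) (step : ∀ u v, H.Adj u v → p u → p v) : p b := by
  rw [reachable_iff_reflTransGen] at h
  induction h with
  | refl => exact ha
  | tail _ hbc ih => exact step _ _ hbc ih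

theorem Reachable.mem_of_within {G : SimpleGraph V} {S : Finset V} {a b : V}
    (h : (G.within S).Reachable a b) (ha : a ∈ S) : b ∈ S :=
  h.propagate ha fun _ _ huv _ => huv.2.2

/-- A path inside `S` all of whose vertices lie in `T`, a set closed under adjacency in `S`,
is a path inside `T`. -/
theorem Reachable.within_of_closed {G : SimpleGraph V} {S T : Finset V} {a b : V}
    (h : (G.within S).Reachable a b) (ha : a ∈ T)
    (hT : ∀ u ∈ T, ∀ v, (G.within S).Adj u v → v ∈ T) : (G.within T).Reachable a b := by
  have := h.propagate (p := fun z => z ∈ T ∧ (G.within T).Reachable a z) ⟨ha, .refl _⟩ ?_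
  · exact this.2
  · rintro u v huv ⟨hu, hr⟩
    have hv := hT u hu v huv
    exact ⟨hv, hr.trans (Adj.reachable ⟨huv.1, hu, hv⟩)⟩

section Degrees

variable (G : SimpleGraph V) [DecidableRel G.Adj]

/-- The number of neighbours of `v` in `S`. -/
def degIn (S : Finset V) (v : V) : ℕ := (S.filter (G.Adj v)).card

/-- The sum of the degrees of the subgraph induced on `S`, that is, twice its number of edges. -/
def degSum (S : Finset V) : ℕ := ∑ v ∈ S, G.degIn S v

theorem degIn_eq_of_closed {S T : Finset V} (hST : S ⊆ T) {v : V}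
    (h : ∀ u ∈ T, G.Adj v u → u ∈ S) : G.degIn S v = G.degIn T v := by
  unfold degIn
  congr 1
  ext u
  simp only [Finset.mem_filter]
  exact ⟨fun hu => ⟨hST hu.1, hu.2⟩, fun hu => ⟨h u hu.1 hu.2, hu.2⟩⟩

variable [DecidableEq V]

theorem degIn_insert {S : Finset V} {x : V} (hx : x ∉ S) (v : V) :
    G.degIn (insert x S) v = G.degIn S v + if G.Adj v x then 1 else 0 := by
  unfold degIn
  rw [Finset.filter_insert]
  split_ifs
  · rw [Finset.card_insert_of_notMem (by simp [hx])]
  · simp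

theorem degIn_erase_self (S : Finset V) (v : V) : G.degIn (S.erase v) v = G.degIn S v := by
  unfold degIn
  congr 1
  ext u
  simp only [Finset.mem_filter, Finset.mem_erase]
  exact ⟨fun h => ⟨h.1.2, h.2⟩, fun h => ⟨⟨h.2.ne.symm, h.1⟩, h.2⟩⟩

theorem degIn_insert_self {S : Finset V} (v : V) : G.degIn (insert v S) v = G.degIn S v := by
  rw [← degIn_erase_self G (insert v S), ← degIn_erase_self G S, Finset.erase_insert_eq_erase]

theorem degSum_insert {S : Finset V} {x : V} (hx : x ∉ S) :
    G.degSum (insert x S) = G.degSum S + 2 * G.degIn S x := by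
  unfold degSum
  rw [Finset.sum_insert hx, degIn_insert_self]
  simp_rw [degIn_insert G hx]
  rw [Finset.sum_add_distrib, ← Finset.card_filter]
  have : (S.filter fun v => G.Adj v x).card = G.degIn S x := by
    simp only [degIn, G.adj_comm x]
  omega

theorem degIn_add_degIn_le [Fintype V] {P Q : Finset V} (h : Disjoint P Q) (v : V) :
    G.degIn P v + G.degIn Q v ≤ G.degree v := by
  unfold degIn
  rw [← card_neighborFinset_eq_degree,
    ← Finset.card_union_of_disjoint (Finset.disjoint_filter_filter h)]
  refine Finset.card_le_card fun u hu => ?_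
  simp only [Finset.mem_union, Finset.mem_filter] at hu
  simp only [mem_neighborFinset]
  tauto

end Degrees

/-! ### Splits with one uncolored vertex -/

theorem colorable_add_of_cover {G : SimpleGraph V} {r s : ℕ} {P Q : Finset V}
    (hcov : ∀ v, v ∈ P ∨ v ∈ Q) (hP : (G.within P).Colorable r) (hQ : (G.within Q).Colorable s) :
    G.Colorable (r + s) := by
  classical
  obtain ⟨f⟩ := hP
  obtain ⟨g⟩ := hQ
  have C : G.Coloring (Fin r ⊕ Fin s) :=
    Coloring.mk (fun v => if v ∈ P then Sum.inl (f v) else Sum.inr (g v)) fun {u v} huv => by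
      by_cases hu : u ∈ P <;> by_cases hv : v ∈ P <;> simp only [hu, hv, if_true, if_false, ne_eq,
        reduceCtorEq, not_false_eq_true, Sum.inl.injEq, Sum.inr.injEq]
      · exact f.valid ⟨huv, hu, hv⟩
      · exact g.valid ⟨huv, (hcov u).resolve_left hu, (hcov v).resolve_left hv⟩
  simpa using C.colorable

/-- `V` is the disjoint union of `{x}`, `P` and `Q`, where `P` is `r`-colorable and `Q` is
`s`-colorable. -/
structure IsSplit (G : SimpleGraph V) (r s : ℕ) (x : V) (P Q : Finset V) : Prop where
  notMem_left : x ∉ P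
  notMem_right : x ∉ Q
  disj : Disjoint P Q
  cover : ∀ v, v = x ∨ v ∈ P ∨ v ∈ Q
  colorable_left : (G.within P).Colorable r
  colorable_right : (G.within Q).Colorable s

namespace IsSplit

variable {G : SimpleGraph V} {r s : ℕ} {x : V} {P Q : Finset V}

theorem symm (h : G.IsSplit r s x P Q) : G.IsSplit s r x Q P :=
  ⟨h.2, h.1, h.3.symm, fun v => by have := h.4 v; tauto, h.6, h.5⟩

variable [DecidableEq V]

theorem not_colorable_insert (h : G.IsSplit r s x P Q) (hG : ¬ G.Colorable (r + s)) :
    ¬ (G.within (insert x P)).Colorable r := fun hc =>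
  hG <| colorable_add_of_cover (fun v => by
    rw [Finset.mem_insert]; have := h.cover v; tauto) hc h.colorable_right

/-- A color missing around `x` could be given to `x`, making the whole graph `(r + s)`-colorable. -/
theorem exists_adj_color (h : G.IsSplit r s x P Q) (hG : ¬ G.Colorable (r + s))
    (C : (G.within P).Coloring (Fin r)) (c : Fin r) : ∃ u ∈ P, G.Adj x u ∧ C u = c := by
  by_contra! hc
  refine h.not_colorable_insert hG ⟨Coloring.mk (Function.update C x c) fun {u v} huv => ?_⟩
  obtain ⟨huv, hu, hv⟩ := huv
  rw [Finset.mem_insert] at hu hv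
  by_cases hux : u = x
  · subst hux
    have hvx : v ≠ u := huv.ne.symm
    simpa [hvx] using (hc v (hv.resolve_left hvx) huv).symm
  · by_cases hvx : v = x
    · subst hvx
      simpa [hux] using hc u (hu.resolve_left hux) huv.symm
    · simpa [hux, hvx] using
        C.valid (show (G.within P).Adj u v from ⟨huv, hu.resolve_left hux, hv.resolve_left hvx⟩)

variable [DecidableRel G.Adj]

theorem le_degIn (h : G.IsSplit r s x P Q) (hG : ¬ G.Colorable (r + s)) : r ≤ G.degIn P x := by
  obtain ⟨C⟩ := h.colorable_left
  have : (Finset.univ : Finset (Fin r)) ⊆ (P.filter (G.Adj x)).image C := fun c _ => by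
    obtain ⟨u, hu, hxu, rfl⟩ := h.exists_adj_color hG C c
    exact Finset.mem_image_of_mem _ (by simp [hu, hxu])
  simpa [degIn] using (Finset.card_le_card this).trans Finset.card_image_le

theorem color_injective (h : G.IsSplit r s x P Q) (hG : ¬ G.Colorable (r + s))
    (hx : G.degIn P x ≤ r) (C : (G.within P).Coloring (Fin r)) {u v : V} (hu : u ∈ P) (hv : v ∈ P)
    (hxu : G.Adj x u) (hxv : G.Adj x v) (huv : C u = C v) : u = v := by
  have := Finset.injOn_of_surjOn_of_card_le (s := P.filter (G.Adj x)) (t := Finset.univ) C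
    (fun _ _ => by simp) (fun c _ => by
      obtain ⟨u, hu, hxu, rfl⟩ := h.exists_adj_color hG C c
      exact ⟨u, by simp [hu, hxu], rfl⟩) (by simpa [degIn] using hx)
  exact this (by simp [hu, hxu]) (by simp [hv, hxv]) huv

/-- The neighbours of `x` in `P` lie in a single component of `P` when there are only `r` of
them. -/
theorem reachable_of_adj (h : G.IsSplit r s x P Q) (hG : ¬ G.Colorable (r + s))
    (hx : G.degIn P x ≤ r) {u v : V} (hu : u ∈ P) (hv : v ∈ P) (hxu : G.Adj x u)
    (hxv : G.Adj x v) : (G.within P).Reachable u v := by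
  classical
  by_contra hr
  obtain ⟨C⟩ := h.colorable_left
  -- Kempe change: swapping the colors of `u` and `v` on the component of `u` alone would free the
  -- color `C u` at `x`.
  let C' : (G.within P).Coloring (Fin r) := Coloring.mk
    (fun z => if (G.within P).Reachable u z then Equiv.swap (C u) (C v) (C z) else C z)
    fun {a b} hab => by
      have hiff : (G.within P).Reachable u a ↔ (G.within P).Reachable u b :=
        ⟨fun h => h.trans hab.reachable, fun h => h.trans hab.symm.reachable⟩
      by_cases ha : (G.within P).Reachable u a
      · simpa [ha, hiff.1 ha] using C.valid hab
      · have hb : ¬ (G.within P).Reachable u b := fun h => ha (hiff.2 h)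
        simpa [ha, hb] using C.valid hab
  obtain ⟨t, ht, hxt, htu⟩ := h.exists_adj_color hG C' (C u)
  change (if (G.within P).Reachable u t then Equiv.swap (C u) (C v) (C t) else C t) = C u at htu
  split_ifs at htu with hut
  · rw [Equiv.swap_apply_eq_iff, Equiv.swap_apply_left] at htu
    exact hr (h.color_injective hG hx C ht hv hxt hxv htu ▸ hut)
  · exact hut (h.color_injective hG hx C ht hu hxt hxu htu ▸ Reachable.refl _)

/-- Each color occurs exactly once around `x` in `P`, so once `y` leaves, `x` can take its color. -/
theorem exchange (h : G.IsSplit r s x P Q) (hG : ¬ G.Colorable (r + s))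
    (hx : G.degIn P x ≤ r) {y : V} (hy : y ∈ P) (hxy : G.Adj x y) :
    G.IsSplit r s y (insert x (P.erase y)) Q where
  notMem_left := by simp [hxy.ne.symm]
  notMem_right := Finset.disjoint_left.1 h.disj hy
  disj := by
    rw [Finset.disjoint_insert_left]
    exact ⟨h.notMem_right, h.disj.mono_left (Finset.erase_subset _ _)⟩
  cover v := by
    have := h.cover v
    simp only [Finset.mem_insert, Finset.mem_erase]
    tauto
  colorable_left := by
    obtain ⟨C⟩ := h.colorable_left
    refine ⟨Coloring.mk (Function.update C x (C y)) fun {u v} huv => ?_⟩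
    obtain ⟨huv, hu, hv⟩ := huv
    simp only [Finset.mem_insert, Finset.mem_erase] at hu hv
    by_cases hux : u = x
    · subst hux
      have hvx : v ≠ u := huv.ne.symm
      have hv := hv.resolve_left hvx
      simp only [Function.update_self, Function.update_of_ne hvx]
      exact fun he => hv.1 (h.color_injective hG hx C hy hv.2 hxy huv he).symm
    · have hu := hu.resolve_left hux
      by_cases hvx : v = x
      · rw [hvx] at huv ⊢
        simp only [Function.update_self, Function.update_of_ne hux]
        exact fun he => hu.1 (h.color_injective hG hx C hu.2 hy huv.symm hxy he)
      · simpa [hux, hvx] using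
          C.valid (show (G.within P).Adj u v from ⟨huv, hu.2, (hv.resolve_left hvx).2⟩)
  colorable_right := h.colorable_right

end IsSplit

/-! ### Optimal splits and regular components -/

/-- A split minimising the number of edges inside its two parts. -/
def IsOptSplit (G : SimpleGraph V) [DecidableRel G.Adj] (r s : ℕ) (x : V) (P Q : Finset V) : Prop :=
  G.IsSplit r s x P Q ∧ ∀ x' P' Q', G.IsSplit r s x' P' Q' →
    G.degSum P + G.degSum Q ≤ G.degSum P' + G.degSum Q'

namespace IsOptSplit

variable {G : SimpleGraph V} [DecidableRel G.Adj] {r s : ℕ} {x : V} {P Q : Finset V}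

theorem symm (h : G.IsOptSplit r s x P Q) : G.IsOptSplit s r x Q P :=
  ⟨h.1.symm, fun x' P' Q' h' => by have := h.2 x' Q' P' h'.symm; omega⟩

variable [DecidableEq V]

/-- By minimality `y` has at most as many neighbours in the new part as `x` had in `P`, hence at
most `r`; non-colorability gives at least `r`. So the edge count is unchanged and the new split is
again optimal. -/
theorem exchange (h : G.IsOptSplit r s x P Q) (hG : ¬ G.Colorable (r + s))
    (hx : G.degIn P x ≤ r) {y : V} (hy : y ∈ P) (hxy : G.Adj x y) :
    G.IsOptSplit r s y (insert x (P.erase y)) Q ∧ G.degIn (insert x (P.erase y)) y ≤ r := by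
  have h1 := h.1.exchange hG hx hy hxy
  have hlow := h1.le_degIn hG
  have hopt := h.2 _ _ _ h1
  have hxP : x ∉ P.erase y := fun hx' => h.1.notMem_left (Finset.mem_of_mem_erase hx')
  have e1 := G.degSum_insert hxP
  have e2 := G.degSum_insert (Finset.notMem_erase y P)
  have e3 := G.degIn_insert hxP y
  have e4 := G.degIn_insert (Finset.notMem_erase y P) x
  rw [Finset.insert_erase hy] at e2 e4
  rw [if_pos hxy] at e4
  rw [if_pos hxy.symm] at e3
  refine ⟨⟨h1, fun x' P' Q' h' => ?_⟩, by omega⟩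
  have := h.2 _ _ _ h'
  omega

/-- Every vertex of the component of `x` in `insert x P` can take over the role of `x`. -/
theorem of_reachable (h : G.IsOptSplit r s x P Q) (hG : ¬ G.Colorable (r + s))
    (hx : G.degIn P x ≤ r) {z : V} (hz : (G.within (insert x P)).Reachable x z) :
    G.IsOptSplit r s z ((insert x P).erase z) Q ∧ G.degIn (insert x P) z ≤ r := by
  refine hz.propagate
    (p := fun z => G.IsOptSplit r s z ((insert x P).erase z) Q ∧ G.degIn (insert x P) z ≤ r) ?_ ?_
  · rw [Finset.erase_insert h.1.notMem_left, degIn_insert_self]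
    exact ⟨h, hx⟩
  · rintro u v ⟨huv, hu, hv⟩ ⟨ho, hd⟩
    rw [← degIn_erase_self] at hd
    have := ho.exchange hG hd (Finset.mem_erase.2 ⟨huv.ne.symm, hv⟩) huv
    have he : insert u (((insert x P).erase u).erase v) = (insert x P).erase v := by
      rw [Finset.erase_right_comm, Finset.insert_erase (Finset.mem_erase.2 ⟨huv.ne, hu⟩)]
    rwa [he, degIn_erase_self] at this

theorem degIn_eq_of_reachable (h : G.IsOptSplit r s x P Q) (hG : ¬ G.Colorable (r + s))
    (hx : G.degIn P x ≤ r) {z : V} (hz : (G.within (insert x P)).Reachable x z) :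
    G.degIn (insert x P) z = r := by
  obtain ⟨h1, h2⟩ := h.of_reachable hG hx hz
  have := h1.1.le_degIn hG
  rw [degIn_erase_self] at this
  omega

theorem degIn_add_of_reachable (h : G.IsOptSplit r s x P Q) (hG : ¬ G.Colorable (r + s))
    (hx : G.degIn P x ≤ r) {u d : V} (hu : u ∈ P) (hxu : G.Adj x u)
    (hd : (G.within P).Reachable u d) :
    G.degIn P d + (if G.Adj d x then 1 else 0) = r := by
  rw [← G.degIn_insert h.1.notMem_left]
  refine h.degIn_eq_of_reachable hG hx (Reachable.trans (Adj.reachable (v := u) ?_)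
    (hd.mono (G.within_mono (Finset.subset_insert x P))))
  exact ⟨hxu, by simp, by simp [hu]⟩

/-- Two vertices attached to the same component of `P` have the same neighbours there. -/
theorem adj_iff_adj (h : G.IsOptSplit r s x P Q) (hG : ¬ G.Colorable (r + s))
    (hx : G.degIn P x ≤ r) {z : V} {Q' : Finset V} (h' : G.IsOptSplit r s z P Q')
    (hz : G.degIn P z ≤ r) {u v d : V} (hu : u ∈ P) (hxu : G.Adj x u) (hv : v ∈ P)
    (hzv : G.Adj z v) (hud : (G.within P).Reachable u d) (hvd : (G.within P).Reachable v d) :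
    G.Adj d x ↔ G.Adj d z := by
  -- Both `x` and `z` complete the degree of `d` to the same `r`, so either both are adjacent to `d`
  -- or neither is.
  have h1 := h.degIn_add_of_reachable hG hx hu hxu hud
  have h2 := h'.degIn_add_of_reachable hG hz hv hzv hvd
  split_ifs at h1 h2 <;> first | tauto | omega

/-- The component of `x` in `insert x P` is not bipartite with the vertices of `L` as one side. -/
theorem exists_adj_pair (h : G.IsOptSplit r s x P Q) (hG : ¬ G.Colorable (r + s)) (hr : 2 ≤ r)
    {L : V → Prop} (hL : ∀ u v, G.Adj u v → L u ∨ L v) :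
    ∃ y y', (G.within (insert x P)).Reachable x y ∧ (G.within (insert x P)).Adj y y' ∧
      L y ∧ L y' := by
  classical
  by_contra! hc
  obtain ⟨C⟩ := h.1.colorable_left
  -- Otherwise the component of `x` is properly 2-colored by membership in `L`, and the other
  -- components keep their colors from `C`.
  refine h.1.not_colorable_insert hG ⟨Coloring.mk (fun z =>
    if (G.within (insert x P)).Reachable x z then
      (if L z then ⟨0, by omega⟩ else ⟨1, by omega⟩ : Fin r) else C z) fun {a b} hab => ?_⟩
  have hiff : (G.within (insert x P)).Reachable x a ↔ (G.within (insert x P)).Reachable x b :=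
    ⟨fun h => h.trans hab.reachable, fun h => h.trans hab.symm.reachable⟩
  by_cases ha : (G.within (insert x P)).Reachable x a
  · have h1 := hc a b ha hab
    have h2 := hL a b hab.1
    by_cases hLa : L a
    · simp [ha, hiff.1 ha, hLa, h1 hLa]
    · simp [ha, hiff.1 ha, hLa, h2.resolve_left hLa]
  · have hb : ¬ (G.within (insert x P)).Reachable x b := fun h => ha (hiff.2 h)
    simp only [ha, hb, if_false]
    refine C.valid (v := a) (w := b) ⟨hab.1, ?_, ?_⟩
    · exact (Finset.mem_insert.1 hab.2.1).resolve_left fun e => ha (e ▸ .refl _)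
    · exact (Finset.mem_insert.1 hab.2.2).resolve_left fun e => hb (e ▸ .refl _)

end IsOptSplit

end SimpleGraph

/-! ### The alternating walk and closed twins -/

namespace SimpleGraph

variable {V : Type*} {G : SimpleGraph V}

theorem Reachable.exists_adj_of_insert [DecidableEq V] {S : Finset V} {y z : V}
    (h : (G.within (insert y S)).Reachable y z) (hz : z ≠ y) :
    ∃ u ∈ S, G.Adj y u ∧ (G.within S).Reachable u z := by
  refine (h.propagate (p := fun z => z = y ∨ ∃ u ∈ S, G.Adj y u ∧ (G.within S).Reachable u z)
    (.inl rfl) ?_).resolve_left hz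
  rintro a b ⟨hab, ha, hb⟩ hp
  by_cases hby : b = y
  · exact .inl hby
  right
  have hb := (Finset.mem_insert.1 hb).resolve_left hby
  by_cases hay : a = y
  · exact ⟨b, hb, hay ▸ hab, .refl _⟩
  · obtain ⟨u, hu, hyu, hua⟩ := hp.resolve_left hay
    have ha := (Finset.mem_insert.1 ha).resolve_left hay
    exact ⟨u, hu, hyu, hua.trans (Adj.reachable ⟨hab, ha, hb⟩)⟩

variable [DecidableEq V] [DecidableRel G.Adj] {r s : ℕ} {x w y : V} {P Q : Finset V}

/-- `D` is a union of components of `S`. -/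
def ClosedIn (G : SimpleGraph V) (S D : Finset V) : Prop :=
  ∀ u ∈ D, ∀ v, (G.within S).Adj u v → v ∈ D

/-- A witness that `b` is not attached to `D` in an `r`-regular fashion. -/
def Blocks (G : SimpleGraph V) [DecidableRel G.Adj] (D : Finset V) (r : ℕ) (b : V) : Prop :=
  ∃ u ∈ D, ∃ d, G.Adj b u ∧ (G.within D).Reachable u d ∧
    G.degIn D d + (if G.Adj d b then 1 else 0) ≠ r

theorem IsOptSplit.not_blocks (h : G.IsOptSplit r s x P Q) (hG : ¬ G.Colorable (r + s))
    (hx : G.degIn P x ≤ r) {D : Finset V} (hD : D ⊆ P) (hc : G.ClosedIn P D) :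
    ¬ G.Blocks D r x := by
  rintro ⟨u, hu, d, hxu, hud, hne⟩
  have hd := hud.mem_of_within hu
  rw [G.degIn_eq_of_closed hD fun v hv hdv => hc d hd v ⟨hdv, hD hd, hv⟩] at hne
  exact hne (h.degIn_add_of_reachable hG hx (hD hu) hxu (hud.mono (G.within_mono hD)))

variable [Fintype V]

/-- Non-colorability forces `r` neighbours in `P` and `s` in `Q`, so a low vertex has none to spare
and can trade into either part. -/
theorem IsSplit.degIn_le_of_degree_le (h : G.IsSplit r s x P Q) (hG : ¬ G.Colorable (r + s))
    (hx : G.degree x ≤ r + s) : G.degIn P x ≤ r ∧ G.degIn Q x ≤ s := by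
  have h1 := h.le_degIn hG
  have h2 := h.symm.le_degIn (by rwa [add_comm] at hG)
  have h3 := G.degIn_add_degIn_le h.disj x
  omega

theorem IsSplit.le_degree (h : G.IsSplit r s x P Q) (hG : ¬ G.Colorable (r + s)) :
    r + s ≤ G.degree x := by
  have h1 := h.le_degIn hG
  have h2 := h.symm.le_degIn (by rwa [add_comm] at hG)
  have h3 := G.degIn_add_degIn_le h.disj x
  omega

/-- If `w` could be attached to the component left behind when `y` replaces `x`, then `x`, `w` and
`y` are closed twins. -/
theorem IsOptSplit.closed_twins (h : G.IsOptSplit r s x P Q) (hG : ¬ G.Colorable (r + s))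
    (hs : 2 ≤ s) (hx : G.degree x ≤ r + s) (hw : G.degree w ≤ r + s) (hy : G.degree y ≤ r + s)
    (hwP : w ∈ P) (hxw : G.Adj x w) (hyx : y ≠ x) (hxy : (G.within (insert x Q)).Reachable x y)
    (hD : ∀ d, (G.within ((insert x Q).erase y)).Reachable x d →
      G.degIn ((insert x Q).erase y) d + (if G.Adj d w then 1 else 0) = s) :
    G.Adj x y ∧ G.Adj w y ∧ insert x (G.neighborFinset x) = insert w (G.neighborFinset w) ∧
      insert x (G.neighborFinset x) = insert y (G.neighborFinset y) := by
  have hG' : ¬ G.Colorable (s + r) := by rwa [add_comm] at hG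
  obtain ⟨tP, tQ⟩ := h.1.degIn_le_of_degree_le hG hx
  have hxP := h.1.notMem_left
  have hxQ := h.1.notMem_right
  have hyQ : y ∈ Q := (Finset.mem_insert.1 (hxy.mem_of_within (by simp))).resolve_left hyx
  obtain ⟨oy, -⟩ := h.symm.of_reachable hG' tQ hxy
  obtain ⟨tyQ, tyP⟩ := oy.1.degIn_le_of_degree_le hG' (by omega)
  have hxQ' : x ∈ (insert x Q).erase y := by simp [hyx.symm]
  have hins : insert y ((insert x Q).erase y) = insert x Q := Finset.insert_erase (by simp [hyQ])
  obtain ⟨y₁, hy₁, hyy₁, hr₁⟩ := Reachable.exists_adj_of_insert (S := (insert x Q).erase y)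
    (by rw [hins]; exact hxy.symm) hyx.symm
  -- Both `w` (by `hD`) and `y` (by optimality) complete each `d` here to degree `s`.
  have key : ∀ d, (G.within ((insert x Q).erase y)).Reachable x d → (G.Adj d w ↔ G.Adj d y) := by
    intro d hd
    have h1 := hD d hd
    have h2 := oy.degIn_add_of_reachable hG' tyQ hy₁ hyy₁ (hr₁.trans hd)
    split_ifs at h1 h2 <;> first | tauto | omega
  have axy : G.Adj x y := (key x (.refl _)).1 hxw
  -- As `s ≥ 2`, `y` has a neighbour `d ≠ x` in its old part. It ties `w` to the component of `Q` to
  -- which `x` is attached, so `x` and `w` can be compared over `Q`.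
  obtain ⟨d, hd, hdx⟩ := Finset.exists_mem_ne
    (show 1 < (((insert x Q).erase y).filter (G.Adj y)).card from
      lt_of_lt_of_le hs (oy.1.le_degIn hG')) x
  obtain ⟨hdQ', hyd⟩ := Finset.mem_filter.1 hd
  have hdQ : d ∈ Q := (Finset.mem_insert.1 (Finset.mem_of_mem_erase hdQ')).resolve_left hdx
  have hxd' := oy.1.reachable_of_adj hG' tyQ hxQ' hdQ' axy.symm hyd
  have hdw : G.Adj d w := (key d hxd').2 hyd.symm
  have hrw : (G.within (insert x P)).Reachable x w := Adj.reachable ⟨hxw, by simp, by simp [hwP]⟩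
  obtain ⟨ow, -⟩ := h.of_reachable hG tP hrw
  obtain ⟨twP, twQ⟩ := ow.1.degIn_le_of_degree_le hG hw
  have hxd : (G.within (insert x Q)).Reachable x d :=
    hxd'.mono (G.within_mono (Finset.erase_subset _ _))
  obtain ⟨e, heQ, hxe, hed⟩ := hxd.exists_adj_of_insert hdx
  have hQw : ∀ z ∈ Q, G.Adj x z → G.Adj z w := fun z hz hxz =>
    have hez := h.symm.1.reachable_of_adj hG' tQ heQ hz hxe hxz
    (h.symm.adj_iff_adj hG' tQ ow.symm twQ heQ hxe hdQ hdw.symm hez (hed.symm.trans hez)).1 hxz.symm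
  have awy : G.Adj w y := (hQw y hyQ axy).symm
  have hQy : ∀ z ∈ Q, G.Adj x z → z ≠ y → G.Adj z y := fun z hz hxz hzy =>
    (key z (Adj.reachable ⟨hxz, hxQ', by simp [hz, hzy]⟩)).1 (hQw z hz hxz)
  have hPy : ∀ z ∈ P, G.Adj x z → G.Adj z y := fun z hz hxz =>
    have hwz := h.1.reachable_of_adj hG tP hwP hz hxw hxz
    (h.adj_iff_adj hG tP oy.symm tyP hwP hxw hwP awy.symm hwz hwz).1 hxz.symm
  -- Reaching `y` through `w` instead leaves `x` inside the left part, where `w` and `y` can now be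
  -- compared.
  obtain ⟨oy', -⟩ := ow.symm.of_reachable hG' twQ (z := y)
    (Adj.reachable ⟨awy, by simp, by simp [hyQ]⟩)
  obtain ⟨-, tyP'⟩ := oy'.1.degIn_le_of_degree_le hG' (by omega)
  have hxP' : x ∈ (insert x P).erase w := by simp [hxw.ne]
  have hPw : ∀ z ∈ P, G.Adj x z → z ≠ w → G.Adj z w := fun z hz hxz hzw =>
    have hr : (G.within ((insert x P).erase w)).Reachable x z :=
      Adj.reachable ⟨hxz, hxP', by simp [hz, hzw]⟩
    (ow.adj_iff_adj hG twP oy'.symm tyP' hxP' hxw.symm hxP' axy.symm hr hr).2 (hPy z hz hxz)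
  have dx := h.1.le_degree hG
  have dw := ow.1.le_degree hG
  have dy := oy.1.le_degree hG'
  -- All three degrees equal `r + s`, so inclusions of closed neighbourhoods suffice.
  refine ⟨axy, awy, Finset.eq_of_subset_of_card_le ?_ ?_, Finset.eq_of_subset_of_card_le ?_ ?_⟩
  · intro z hz
    rw [Finset.mem_insert, mem_neighborFinset] at hz ⊢
    rcases hz with rfl | hz
    · exact .inr hxw.symm
    · by_cases hzw : z = w
      · exact .inl hzw
      · rcases h.1.cover z with rfl | hzP | hzQ
        · exact (hz.ne rfl).elim
        · exact .inr (hPw z hzP hz hzw).symm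
        · exact .inr (hQw z hzQ hz).symm
  · rw [Finset.card_insert_of_notMem (by simp), Finset.card_insert_of_notMem (by simp),
      card_neighborFinset_eq_degree, card_neighborFinset_eq_degree]
    omega
  · intro z hz
    rw [Finset.mem_insert, mem_neighborFinset] at hz ⊢
    rcases hz with rfl | hz
    · exact .inr axy.symm
    · by_cases hzy : z = y
      · exact .inl hzy
      · rcases h.1.cover z with rfl | hzP | hzQ
        · exact (hz.ne rfl).elim
        · exact .inr (hPy z hzP hz).symm
        · exact .inr (hQy z hzQ hz hzy).symm
  · rw [Finset.card_insert_of_notMem (by simp), Finset.card_insert_of_notMem (by simp),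
      card_neighborFinset_eq_degree, card_neighborFinset_eq_degree]
    omega

/-- A stage of the walk: `x` is uncolored, and it has just replaced a vertex next to `w`. The set
`F` is a union of components, each containing a low vertex that cannot become uncolored. -/
structure IsStage (G : SimpleGraph V) [DecidableRel G.Adj] (r s : ℕ) (x w : V) (P Q F : Finset V) :
    Prop where
  opt : G.IsOptSplit r s x P Q
  low_x : G.degree x ≤ r + s
  low_w : G.degree w ≤ r + s
  mem : w ∈ P
  adj : G.Adj x w
  subset : F ⊆ P ∪ Q
  closed_left : G.ClosedIn P F
  closed_right : G.ClosedIn Q F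
  fresh : ∀ a ∈ F, ¬ (G.within P).Reachable w a
  blocked_left : ∀ a ∈ F, a ∈ P → ∃ b, G.degree b ≤ r + s ∧ (G.within (F ∩ P)).Reachable a b ∧
    ∃ D ⊆ Q, D ⊆ F ∧ G.ClosedIn Q D ∧ G.Blocks D s b
  -- Here the blocking set may also use the component of `w`, which joins `F` only at the next
  -- stage.
  blocked_right : ∀ a ∈ F, a ∈ Q → ∃ b, G.degree b ≤ r + s ∧ (G.within (F ∩ Q)).Reachable a b ∧
    ∃ D ⊆ P, (∀ d ∈ D, d ∈ F ∨ (G.within P).Reachable w d) ∧ G.ClosedIn P D ∧ G.Blocks D r b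

/-- The component of `x` in `Q + x` avoids `F`, since it would otherwise let a blocked low vertex
become uncolored. So the walk can leave through a low `y` there without disturbing `F`, and the
component of `w` is added to `F`. -/
theorem IsStage.exists_next {F : Finset V} (h : G.IsStage r s x w P Q F)
    (hG : ¬ G.Colorable (r + s)) (hs : 2 ≤ s)
    (hlow : ∀ u v, G.Adj u v → G.degree u ≤ r + s ∨ G.degree v ≤ r + s)
    (htwins : ∀ x w y, G.degree x = r + s → G.Adj x w → G.Adj x y → G.Adj w y →
      insert x (G.neighborFinset x) = insert w (G.neighborFinset w) →
      insert x (G.neighborFinset x) ≠ insert y (G.neighborFinset y)) :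
    ∃ x' w' P' Q' F', G.IsStage s r x' w' P' Q' F' ∧ F.card < F'.card := by
  classical
  have hG' : ¬ G.Colorable (s + r) := by rwa [add_comm] at hG
  obtain ⟨tP, tQ⟩ := h.opt.1.degIn_le_of_degree_le hG h.low_x
  have hxP := h.opt.1.notMem_left
  have hxQ := h.opt.1.notMem_right
  have hPQ := h.opt.1.disj
  have hxF : x ∉ F := fun hx => by simpa [hxP, hxQ] using h.subset hx
  obtain ⟨y, y', hxy, hyy', ly, ly', hyx⟩ : ∃ y y', (G.within (insert x Q)).Reachable x y ∧
      (G.within (insert x Q)).Adj y y' ∧ G.degree y ≤ r + s ∧ G.degree y' ≤ r + s ∧ y ≠ x := by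
    obtain ⟨y, y', hxy, hyy', ly, ly'⟩ := h.opt.symm.exists_adj_pair hG' hs hlow
    by_cases hyx : y = x
    · exact ⟨y', y, hxy.trans hyy'.reachable, hyy'.symm, ly', ly, fun h => hyy'.ne (hyx.trans h.symm)⟩
    · exact ⟨y, y', hxy, hyy', ly, ly', hyx⟩
  obtain ⟨oy, -⟩ := h.opt.symm.of_reachable hG' tQ hxy
  obtain ⟨tyQ, tyP⟩ := oy.1.degIn_le_of_degree_le hG' (by omega)
  -- the component of `x` avoids `F`
  have hZF : ∀ a ∈ F, ¬ (G.within (insert x Q)).Reachable x a := by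
    intro a ha hxa
    have haQ := (Finset.mem_insert.1 (hxa.mem_of_within (by simp))).resolve_left
      fun e => hxF (e ▸ ha)
    obtain ⟨b, lb, hab, D, hDP, -, hDc, hDb⟩ := h.blocked_right a ha haQ
    have hxb := hxa.trans (hab.mono (G.within_mono
      (Finset.inter_subset_right.trans (Finset.subset_insert x Q))))
    obtain ⟨ob, -⟩ := h.opt.symm.of_reachable hG' tQ hxb
    exact ob.symm.not_blocks hG (ob.symm.1.degIn_le_of_degree_le hG lb).1 hDP hDc hDb
  have hyQ : y ∈ Q := (Finset.mem_insert.1 hyy'.2.1).resolve_left hyx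
  have hyF : y ∉ F := fun hy => hZF y hy hxy
  have hxQ' : x ∈ (insert x Q).erase y := by simp [hyx.symm]
  have hy'Q' : y' ∈ (insert x Q).erase y := Finset.mem_erase.2 ⟨hyy'.1.ne.symm, hyy'.2.2⟩
  have hQ'Q : (insert x Q).erase y ⊆ insert x Q := Finset.erase_subset _ _
  have hxF' : ∀ a ∈ F, (G.within (insert x Q)).Adj a x → False := fun a ha hax =>
    hZF a ha hax.symm.reachable
  have hins : insert y ((insert x Q).erase y) = insert x Q := Finset.insert_erase (by simp [hyQ])
  -- `x` and `y'` lie in the same component after the exchange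
  have hy'x : (G.within ((insert x Q).erase y)).Reachable y' x := by
    obtain ⟨y₁, hy₁, hyy₁, hr₁⟩ := Reachable.exists_adj_of_insert (S := (insert x Q).erase y)
      (by rw [hins]; exact hxy.symm) hyx.symm
    exact (oy.1.reachable_of_adj hG' tyQ hy'Q' hy₁ hyy'.1 hyy₁).trans hr₁
  let A : Finset V := Finset.univ.filter fun a => (G.within P).Reachable w a
  have hA : ∀ a, a ∈ A ↔ (G.within P).Reachable w a := fun a => by simp [A]
  have hAP : A ⊆ P := fun a ha => ((hA a).1 ha).mem_of_within h.mem
  have hAc : G.ClosedIn P A := fun u hu v huv => (hA v).2 (((hA u).1 hu).trans huv.reachable)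
  let D : Finset V := Finset.univ.filter fun a => (G.within ((insert x Q).erase y)).Reachable x a
  have hD : ∀ a, a ∈ D ↔ (G.within ((insert x Q).erase y)).Reachable x a := fun a => by simp [D]
  have hDQ' : D ⊆ (insert x Q).erase y := fun a ha => ((hD a).1 ha).mem_of_within hxQ'
  have hDc : G.ClosedIn ((insert x Q).erase y) D := fun u hu v huv =>
    (hD v).2 (((hD u).1 hu).trans huv.reachable)
  -- If `w` fitted onto `D` regularly, `x`, `w`, `y` would be the excluded closed twins.
  have hblock : G.Blocks D s w := by
    by_contra hb
    obtain ⟨axy, awy, e1, e2⟩ := h.opt.closed_twins hG hs h.low_x h.low_w ly h.mem h.adj hyx hxy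
      fun d hd => by
        by_contra hne
        have hdD := (hD d).2 hd
        refine hb ⟨x, (hD x).2 (.refl _), d, h.adj.symm,
          hd.within_of_closed ((hD x).2 (.refl _)) hDc, ?_⟩
        rwa [G.degIn_eq_of_closed hDQ' fun v hv hdv => hDc d hdD v ⟨hdv, hDQ' hdD, hv⟩]
    exact htwins x w y (le_antisymm h.low_x (h.opt.1.le_degree hG)) h.adj axy awy e1 e2
  have hmonoQ : F ∩ Q ⊆ (F ∪ A) ∩ (insert x Q).erase y := fun a ha => by
    obtain ⟨haF, haQ⟩ := Finset.mem_inter.1 ha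
    simp only [Finset.mem_inter, Finset.mem_union, Finset.mem_erase, Finset.mem_insert]
    exact ⟨.inl haF, fun e => hyF (e ▸ haF), .inr haQ⟩
  -- The two parts swap roles: the next move takes place in `P`.
  refine ⟨y, y', (insert x Q).erase y, P, F ∪ A, ⟨oy, by omega, by omega, hy'Q', hyy'.1, ?_, ?_, ?_,
    ?_, ?_, ?_⟩, ?_⟩
  · intro a ha
    rcases Finset.mem_union.1 ha with haF | haA
    · have := h.subset haF
      simp only [Finset.mem_union, Finset.mem_erase, Finset.mem_insert] at this ⊢
      have : a ≠ y := fun e => hyF (e ▸ haF)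
      tauto
    · exact Finset.mem_union_right _ (hAP haA)
  · rintro u hu v ⟨huv, huQ, hvQ⟩
    rcases Finset.mem_union.1 hu with huF | huA
    · replace huQ := (Finset.mem_insert.1 (hQ'Q huQ)).resolve_left fun e => hxF (e ▸ huF)
      rcases Finset.mem_insert.1 (hQ'Q hvQ) with rfl | hvQ
      · exact (hxF' u huF ⟨huv, by simp [huQ], by simp⟩).elim
      · exact Finset.mem_union_left _ (h.closed_right u huF v ⟨huv, huQ, hvQ⟩)
    · rcases Finset.mem_insert.1 (hQ'Q huQ) with rfl | huQ
      · exact (hxP (hAP huA)).elim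
      · exact (Finset.disjoint_left.1 hPQ (hAP huA) huQ).elim
  · intro u hu v huv
    rcases Finset.mem_union.1 hu with huF | huA
    · exact Finset.mem_union_left _ (h.closed_left u huF v huv)
    · exact Finset.mem_union_right _ (hAc u huA v huv)
  · intro a ha hr
    have haZ := hQ'Q (hr.mem_of_within hy'Q')
    rcases Finset.mem_union.1 ha with haF | haA
    · exact hZF a haF ((hxy.trans hyy'.reachable).trans (hr.mono (G.within_mono hQ'Q)))
    · rcases Finset.mem_insert.1 haZ with rfl | haQ
      · exact hxP (hAP haA)
      · exact Finset.disjoint_left.1 hPQ (hAP haA) haQ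
  · intro a ha haQ
    have haF : a ∈ F := (Finset.mem_union.1 ha).resolve_right fun haA => by
      rcases Finset.mem_insert.1 (hQ'Q haQ) with rfl | haQ
      · exact hxP (hAP haA)
      · exact Finset.disjoint_left.1 hPQ (hAP haA) haQ
    have haQ := (Finset.mem_insert.1 (hQ'Q haQ)).resolve_left fun e => hxF (e ▸ haF)
    obtain ⟨b, lb, hab, E, hEP, hEF, hEc, hEb⟩ := h.blocked_right a haF haQ
    exact ⟨b, by omega, hab.mono (G.within_mono hmonoQ), E, hEP,
      fun d hd => Finset.mem_union.2 ((hEF d hd).imp_right (hA d).2), hEc, hEb⟩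
  · intro a ha haP
    rcases Finset.mem_union.1 ha with haF | haA
    · obtain ⟨b, lb, hab, E, hEQ, hEF, hEc, hEb⟩ := h.blocked_left a haF haP
      refine ⟨b, by omega, hab.mono (G.within_mono (Finset.inter_subset_inter_right
        Finset.subset_union_left)), E, fun d hd => ?_, fun d hd =>
        .inl (Finset.mem_union_left _ (hEF hd)), ?_, hEb⟩
      · have : d ≠ y := fun e => hyF (e ▸ hEF hd)
        simp [this, hEQ hd]
      · rintro u hu v ⟨huv, -, hvQ⟩
        rcases Finset.mem_insert.1 (hQ'Q hvQ) with rfl | hvQ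
        · exact (hxF' u (hEF hu) ⟨huv, by simp [hEQ hu], by simp⟩).elim
        · exact hEc u hu v ⟨huv, hEQ hu, hvQ⟩
    -- `w` is the blocked low vertex of the new component `A`; its blocking set `D` lies in the
    -- component of `y'`, the next `w`.
    · refine ⟨w, by have := h.low_w; omega, ?_, D, hDQ', fun d hd =>
        .inr (hy'x.trans ((hD d).1 hd)), hDc, hblock⟩
      have hwA : w ∈ A := (hA w).2 (.refl _)
      exact ((((hA a).1 haA).within_of_closed hwA hAc).mono (G.within_mono
        (Finset.subset_inter Finset.subset_union_right hAP))).symm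
  · refine Finset.card_lt_card ⟨Finset.subset_union_left, fun hsub => ?_⟩
    exact h.fresh w (hsub (Finset.mem_union_right _ ((hA w).2 (.refl _)))) (.refl _)

/-- Each stage yields another with a larger `F`, impossible in a finite graph. -/
theorem not_isStage {F : Finset V} (hG : ¬ G.Colorable (r + s)) (hr : 2 ≤ r) (hs : 2 ≤ s)
    (hlow : ∀ u v, G.Adj u v → G.degree u ≤ r + s ∨ G.degree v ≤ r + s)
    (htwins : ∀ x w y, G.degree x = r + s → G.Adj x w → G.Adj x y → G.Adj w y →
      insert x (G.neighborFinset x) = insert w (G.neighborFinset w) →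
      insert x (G.neighborFinset x) ≠ insert y (G.neighborFinset y)) :
    ¬ G.IsStage r s x w P Q F := by
  induction hn : Fintype.card V - F.card using Nat.strong_induction_on
    generalizing r s x w P Q F with
  | _ n ih =>
    intro h
    obtain ⟨x', w', P', Q', F', h', hF⟩ := h.exists_next hG hs hlow htwins
    have hF' := F'.card_le_univ
    rw [add_comm] at hG hlow htwins
    exact ih (Fintype.card V - F'.card) (by omega) hG hs hr hlow htwins rfl h'

/-- In a graph that is not `(r + s)`-colorable, whose vertices of degree above `r + s` are
independent and have degree `r + s + 1`, an optimal split yields three closed twins. -/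
theorem IsOptSplit.exists_twins (h : G.IsOptSplit r s x P Q) (hG : ¬ G.Colorable (r + s))
    (hr : 2 ≤ r) (hs : 2 ≤ s) (hdeg : ∀ v, G.degree v ≤ r + s + 1)
    (hlow : ∀ u v, G.Adj u v → G.degree u ≤ r + s ∨ G.degree v ≤ r + s) :
    ∃ x w y, G.degree x = r + s ∧ G.Adj x w ∧ G.Adj x y ∧ G.Adj w y ∧
      insert x (G.neighborFinset x) = insert w (G.neighborFinset w) ∧
      insert x (G.neighborFinset x) = insert y (G.neighborFinset y) := by
  by_contra! htwins
  -- The first `x` may have degree `r + s + 1`, but its one surplus neighbour spoils only one of the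
  -- two parts.
  wlog tP : G.degIn P x ≤ r generalizing r s P Q
  · have h1 := h.1.symm.le_degIn (by rwa [add_comm] at hG)
    have h2 := G.degIn_add_degIn_le h.1.disj x
    have h3 := hdeg x
    rw [add_comm r s] at *
    exact this h.symm hG hs hr hdeg hlow htwins (by omega)
  obtain ⟨y, y', hxy, hyy', ly, ly'⟩ := h.exists_adj_pair hG hr hlow
  obtain ⟨oy, -⟩ := h.of_reachable hG tP hxy
  refine not_isStage (F := ∅) hG hr hs hlow htwins (x := y) (w := y') (P := (insert x P).erase y)
    (Q := Q) ⟨oy, ly, ly', Finset.mem_erase.2 ⟨hyy'.1.ne.symm, hyy'.2.2⟩, hyy'.1, ?_, ?_, ?_, ?_,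
      ?_, ?_⟩ <;> simp [ClosedIn]

end SimpleGraph

/-! ### From closed twins to a clique -/

namespace SimpleGraph

variable {V : Type*} {G : SimpleGraph V}

/-- If `T` is joined completely to `Q`, has no other neighbours and `#T + #Q = m + 1`, then in a
graph that is not `m`-colorable, every `m`-coloring of `G - T` uses distinct colors on `Q`. -/
theorem injOn_of_not_colorable {m : ℕ} {T Q : Finset V} (hG : ¬ G.Colorable m)
    (hcard : T.card + Q.card = m + 1)
    (hTQ : ∀ t ∈ T, ∀ z, G.Adj t z → z ∈ T ∨ z ∈ Q) {g : V → Fin m}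
    (hg : ∀ a b, a ∉ T → b ∉ T → G.Adj a b → g a ≠ g b) : Set.InjOn g Q := by
  classical
  rw [← Finset.card_image_iff]
  refine le_antisymm Finset.card_image_le (not_lt.1 fun hlt => hG ?_)
  -- A repeated color on `Q` leaves at least `#T` colors unused there, enough to color `T`
  -- injectively.
  obtain ⟨φ⟩ : Nonempty (T ↪ {c : Fin m // c ∉ Q.image g}) := by
    refine Function.Embedding.nonempty_of_card_le ?_
    rw [Fintype.card_subtype_compl, Fintype.card_coe, Fintype.card_coe, Fintype.card_fin]
    omega
  refine ⟨Coloring.mk (fun v => if hv : v ∈ T then (φ ⟨v, hv⟩ : Fin m) else g v)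
    fun {a b} hab => ?_⟩
  have key : ∀ t z (ht : t ∈ T), z ∉ T → G.Adj t z → (φ ⟨t, ht⟩ : Fin m) ≠ g z :=
    fun t z ht hz htz e => (φ ⟨t, ht⟩).2 (e ▸ Finset.mem_image_of_mem g
      ((hTQ t ht z htz).resolve_left hz))
  by_cases ha : a ∈ T <;> by_cases hb : b ∈ T <;> simp only [ha, hb, dif_pos, dif_neg,
    not_false_eq_true]
  · intro e
    have := φ.injective (Subtype.ext e)
    exact hab.ne (congrArg Subtype.val this)
  · exact key a b ha hb hab
  · exact (key b a hb ha hab.symm).symm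
  · exact hg a b ha hb hab

variable [Fintype V] [DecidableEq V] [DecidableRel G.Adj]

/-- In a graph that is not `m`-colorable and whose vertices of degree above `m` are independent and
have degree `m + 1`, three vertices of degree `m` with the same closed neighbourhood lie in a clique
on `m + 1` vertices. -/
theorem isClique_of_closed_twins {m : ℕ} (hm : 5 ≤ m) (hG : ¬ G.Colorable m)
    (hdeg : ∀ v, G.degree v ≤ m + 1)
    (hlow : ∀ u v, G.Adj u v → G.degree u ≤ m ∨ G.degree v ≤ m)
    {x w y : V} (hx : G.degree x = m) (hxw : G.Adj x w) (hxy : G.Adj x y) (hwy : G.Adj w y)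
    (ew : insert x (G.neighborFinset x) = insert w (G.neighborFinset w))
    (ey : insert x (G.neighborFinset x) = insert y (G.neighborFinset y))
    {f : V → Fin m} (hf : ∀ a b, a ≠ x → b ≠ x → G.Adj a b → f a ≠ f b) :
    ∀ u ∈ insert x (G.neighborFinset x), ∀ v ∈ insert x (G.neighborFinset x),
      u ≠ v → G.Adj u v := by
  set W := insert x (G.neighborFinset x) with hWdef
  have hW : W.card = m + 1 := by
    rw [hWdef, Finset.card_insert_of_notMem (by simp), card_neighborFinset_eq_degree, hx]
  let T := W.filter fun t => insert t (G.neighborFinset t) = W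
  let Q := W.filter fun t => ¬ insert t (G.neighborFinset t) = W
  have hTQ : T.card + Q.card = m + 1 := by
    rw [← hW]; exact Finset.card_filter_add_card_filter_not _
  have hQW : ∀ u ∈ Q, u ∈ W := fun u hu => (Finset.mem_filter.1 hu).1
  have hQT : ∀ u ∈ Q, u ∉ T := fun u hu hu' => (Finset.mem_filter.1 hu).2 (Finset.mem_filter.1 hu').2
  have hWTQ : ∀ u ∈ W, u ∈ T ∨ u ∈ Q := fun u hu => by
    by_cases h : insert u (G.neighborFinset u) = W
    · exact .inl (Finset.mem_filter.2 ⟨hu, h⟩)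
    · exact .inr (Finset.mem_filter.2 ⟨hu, h⟩)
  have hTW : ∀ t ∈ T, ∀ z, z ∈ W ↔ z = t ∨ G.Adj t z := fun t ht z => by
    rw [← (Finset.mem_filter.1 ht).2]; simp
  have hxT : x ∈ T := Finset.mem_filter.2 ⟨by simp [W], rfl⟩
  have hT3 : 3 ≤ T.card := by
    have : ({x, w, y} : Finset V) ⊆ T := by
      intro z hz
      simp only [Finset.mem_insert, Finset.mem_singleton] at hz
      rcases hz with rfl | rfl | rfl
      · exact hxT
      · exact Finset.mem_filter.2 ⟨by rw [ew]; simp, ew.symm⟩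
      · exact Finset.mem_filter.2 ⟨by rw [ey]; simp, ey.symm⟩
    calc 3 = ({x, w, y} : Finset V).card := by
          rw [Finset.card_eq_three.2 ⟨x, w, y, hxw.ne, hxy.ne, hwy.ne, rfl⟩]
      _ ≤ _ := Finset.card_le_card this
  have hinj : ∀ g : V → Fin m, (∀ a b, a ∉ T → b ∉ T → G.Adj a b → g a ≠ g b) →
      Set.InjOn g Q := fun g hg => injOn_of_not_colorable hG hTQ
    (fun t ht z htz => hWTQ z ((hTW t ht z).2 (.inr htz))) hg
  have hfT : ∀ a b, a ∉ T → b ∉ T → G.Adj a b → f a ≠ f b := fun a b ha hb =>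
    hf a b (fun e => ha (e ▸ hxT)) (fun e => hb (e ▸ hxT))
  -- The colors `u` may receive when the rest of `G - T` keeps `f`. Injectivity on `Q` of every
  -- coloring of `G - T` makes these sets avoid the other colors on `Q`, and be disjoint for
  -- nonadjacent vertices.
  let free : V → Finset (Fin m) := fun u =>
    Finset.univ.filter fun c => ∀ z, G.Adj u z → z ∉ T → f z ≠ c
  have hfree : ∀ u c, c ∈ free u → ∀ z, G.Adj u z → z ∉ T → f z ≠ c := fun u c hc =>
    (Finset.mem_filter.1 hc).2
  have hfree_card : ∀ u ∈ Q, m + T.card ≤ (free u).card + G.degree u := by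
    intro u hu
    have hTu : T ⊆ G.neighborFinset u := fun t ht => by
      have := ((hTW t ht u).1 (hQW u hu)).resolve_left fun e => hQT u hu (e ▸ ht)
      simpa using this.symm
    have h1 : (Finset.univ \ (G.neighborFinset u \ T).image f) ⊆ free u := by
      intro c hc
      refine Finset.mem_filter.2 ⟨Finset.mem_univ _, fun z hz hzT e => ?_⟩
      exact (Finset.mem_sdiff.1 hc).2 (e ▸ Finset.mem_image_of_mem f (by simp [hz, hzT]))
    have h2 := Finset.card_le_card h1
    have h3 : ((G.neighborFinset u \ T).image f).card ≤ _ := Finset.card_image_le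
    rw [Finset.card_sdiff_of_subset hTu, card_neighborFinset_eq_degree] at h3
    rw [Finset.card_sdiff_of_subset (Finset.subset_univ _), Finset.card_univ, Fintype.card_fin] at h2
    have h4 := Finset.card_le_card hTu
    rw [card_neighborFinset_eq_degree] at h4
    omega
  have hdisj_color : ∀ u ∈ Q, ∀ z ∈ Q, u ≠ z → f z ∉ free u := by
    intro u hu z hz huz hc
    refine huz (hinj (Function.update f u (f z)) (fun a b ha hb hab => ?_) hu hz
      (by simp [huz.symm]))
    by_cases hau : a = u
    · have hbu : b ≠ u := fun e => hab.ne (hau.trans e.symm)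
      rw [hau] at hab ⊢
      simpa [hbu] using (hfree u _ hc b hab hb).symm
    · by_cases hbu : b = u
      · rw [hbu] at hab ⊢
        simpa [hau] using hfree u _ hc a hab.symm ha
      · simpa [hau, hbu] using hfT a b ha hb hab
  have hdisj_free : ∀ u ∈ Q, ∀ v ∈ Q, u ≠ v → ¬ G.Adj u v → Disjoint (free u) (free v) := by
    intro u hu v hv huv hnadj
    refine Finset.disjoint_left.2 fun c hcu hcv => ?_
    refine huv (hinj (fun z => if z = u ∨ z = v then c else f z) (fun a b ha hb hab => ?_) hu hv
      (by simp))
    by_cases hauv : a = u ∨ a = v <;> by_cases hbuv : b = u ∨ b = v <;>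
      simp only [hauv, hbuv, if_true, if_false]
    · rcases hauv with rfl | rfl <;> rcases hbuv with rfl | rfl
      · exact (hab.ne rfl).elim
      · exact (hnadj hab).elim
      · exact (hnadj hab.symm).elim
      · exact (hab.ne rfl).elim
    · rcases hauv with rfl | rfl
      · exact (hfree _ _ hcu b hab hb).symm
      · exact (hfree _ _ hcv b hab hb).symm
    · rcases hbuv with rfl | rfl
      · exact hfree _ _ hcu a hab.symm ha
      · exact hfree _ _ hcv a hab.symm ha
    · exact hfT a b ha hb hab
  have hsum : ∀ S ⊆ Q, (∀ u ∈ S, ∀ v ∈ S, u ≠ v → ¬ G.Adj u v) →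
      ∑ u ∈ S, (free u).card + (Q \ S).card ≤ m := by
    intro S hS hind
    rw [← Finset.card_biUnion fun u hu v hv huv =>
      hdisj_free u (hS hu) v (hS hv) huv (hind u hu v hv huv),
      ← Finset.card_image_of_injOn (f := f) ((hinj f hfT).mono (by simp)),
      ← Finset.card_union_of_disjoint]
    · simpa using Finset.card_le_univ (S.biUnion free ∪ (Q \ S).image f)
    · refine Finset.disjoint_left.2 fun c hc hc' => ?_
      obtain ⟨u, hu, hcu⟩ := Finset.mem_biUnion.1 hc
      obtain ⟨z, hz, rfl⟩ := Finset.mem_image.1 hc'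
      obtain ⟨hzQ, hzS⟩ := Finset.mem_sdiff.1 hz
      exact hdisj_color u (hS hu) z hzQ (fun e => hzS (e ▸ hu)) hcu
  -- Counting colors gives `2m + #T - 1 ≤ deg u + deg v ≤ 2m + 2`; as `#T ≥ 3`, equality holds
  -- throughout.
  have hpair : ∀ u ∈ Q, ∀ v ∈ Q, u ≠ v → ¬ G.Adj u v → G.degree u = m + 1 ∧ Q.card + 2 = m := by
    intro u hu v hv huv hnadj
    have h1 := hsum {u, v} (by intro z; simp only [Finset.mem_insert, Finset.mem_singleton];
                               rintro (rfl | rfl) <;> assumption) (by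
      intro a ha b hb hab
      simp only [Finset.mem_insert, Finset.mem_singleton] at ha hb
      rcases ha with rfl | rfl <;> rcases hb with rfl | rfl
      · exact (hab rfl).elim
      · exact hnadj
      · exact fun h => hnadj h.symm
      · exact (hab rfl).elim)
    rw [Finset.sum_pair huv] at h1
    have h2 := Finset.le_card_sdiff {u, v} Q
    rw [Finset.card_pair huv] at h2
    have h3 := hfree_card u hu
    have h4 := hfree_card v hv
    have h5 := hdeg u
    have h6 := hdeg v
    omega
  have hmemQ : ∀ u ∈ W, ∀ v ∈ W, u ≠ v → ¬ G.Adj u v → u ∈ Q := fun u hu v hv huv hn =>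
    (hWTQ u hu).resolve_left fun hT => hn (((hTW u hT v).1 hv).resolve_left huv.symm)
  by_contra! hne
  obtain ⟨u, hu, v, hv, huv, hnadj⟩ := hne
  obtain ⟨-, hQ⟩ := hpair u (hmemQ u hu v hv huv hnadj) v
    (hmemQ v hv u hu huv.symm fun h => hnadj h.symm) huv hnadj
  have hhigh : ∀ z ∈ Q, G.degree z = m + 1 := by
    intro z hz
    by_contra hzd
    refine (Finset.mem_filter.1 hz).2 (Finset.eq_of_subset_of_card_le (fun a ha => ?_) ?_).symm
    · rw [Finset.mem_insert, mem_neighborFinset]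
      by_contra! hn
      exact hzd (hpair z hz a (hmemQ a ha z (hQW z hz) hn.1 fun h => hn.2 h.symm) hn.1.symm hn.2).1
    · rw [Finset.card_insert_of_notMem (by simp), card_neighborFinset_eq_degree, hW]
      have := hdeg z
      omega
  -- Now all of `Q` is high, hence independent, with two free colors per vertex: `2(m - 2) ≤ m`
  -- contradicts `m ≥ 5`.
  have h1 := hsum Q subset_rfl fun a ha b hb _ hab => by
    have := hlow a b hab
    have := hhigh a ha
    have := hhigh b hb
    omega
  have h2 : ∑ _u ∈ Q, 2 ≤ ∑ u ∈ Q, (free u).card := Finset.sum_le_sum fun z hz => by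
    have := hfree_card z hz
    have := hhigh z hz
    omega
  rw [Finset.sum_const, smul_eq_mul] at h2
  omega

end SimpleGraph

/-! ### Assembling the theorem -/

namespace SimpleGraph

variable {V : Type*} {G : SimpleGraph V} [Fintype V] [DecidableRel G.Adj]

theorem exists_isOptSplit {r s : ℕ} (hr : 0 < r) (hs : 0 < s)
    (x : V) {f : V → Fin (r + s)} (hf : ∀ a b, a ≠ x → b ≠ x → G.Adj a b → f a ≠ f b) :
    ∃ x P Q, G.IsOptSplit r s x P Q := by
  classical
  let g : V → Fin r ⊕ Fin s := fun v => finSumFinEquiv.symm (f v)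
  have hg : ∀ a b, a ≠ x → b ≠ x → G.Adj a b → g a ≠ g b := fun a b ha hb hab e =>
    hf a b ha hb hab (finSumFinEquiv.symm.injective e)
  have h0 : G.IsSplit r s x (Finset.univ.filter fun v => v ≠ x ∧ (g v).isLeft = true)
      (Finset.univ.filter fun v => v ≠ x ∧ (g v).isRight = true) := by
    refine ⟨by simp, by simp, ?_, fun v => ?_, ⟨Coloring.mk
      (fun v => (g v).elim id fun _ => ⟨0, hr⟩) fun {a b} hab => ?_⟩, ⟨Coloring.mk
      (fun v => (g v).elim (fun _ => ⟨0, hs⟩) id) fun {a b} hab => ?_⟩⟩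
    · refine Finset.disjoint_left.2 fun v h1 h2 => ?_
      rw [Finset.mem_filter] at h1 h2
      cases h : g v <;> simp [h] at h1 h2
    · cases h : g v <;> simp [h, em]
    · obtain ⟨hab, ha, hb⟩ := hab
      simp only [Finset.mem_filter, Finset.mem_univ, true_and, Sum.isLeft_iff] at ha hb
      obtain ⟨hax, i, hi⟩ := ha
      obtain ⟨hbx, j, hj⟩ := hb
      have := hg a b hax hbx hab
      simpa [hi, hj] using this
    · obtain ⟨hab, ha, hb⟩ := hab
      simp only [Finset.mem_filter, Finset.mem_univ, true_and, Sum.isRight_iff] at ha hb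
      obtain ⟨hax, i, hi⟩ := ha
      obtain ⟨hbx, j, hj⟩ := hb
      have := hg a b hax hbx hab
      simpa [hi, hj] using this
  have hp : ∃ n x P Q, G.IsSplit r s x P Q ∧ G.degSum P + G.degSum Q = n :=
    ⟨_, x, _, _, h0, rfl⟩
  obtain ⟨y, P, Q, h, hn⟩ := Nat.find_spec hp
  exact ⟨y, P, Q, h, fun x' P' Q' h' => hn ▸ Nat.find_min' hp ⟨x', P', Q', h', rfl⟩⟩

theorem eq_top_of_critical {m : ℕ} (hm : 5 ≤ m) (hG : ¬ G.Colorable m)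
    (hcol : ∀ x, ∃ f : V → Fin m, ∀ a b, a ≠ x → b ≠ x → G.Adj a b → f a ≠ f b)
    (hdeg : ∀ v, G.degree v ≤ m + 1)
    (hlow : ∀ u v, G.Adj u v → G.degree u ≤ m ∨ G.degree v ≤ m) [Nonempty V] :
    G = ⊤ ∧ Fintype.card V = m + 1 := by
  classical
  -- Any division with at least two colors on each side would do.
  obtain ⟨s, rfl⟩ : ∃ s, m = 2 + s := ⟨m - 2, by omega⟩
  obtain ⟨f₀, hf₀⟩ := hcol (Classical.arbitrary V)
  obtain ⟨z, P, Q, hz⟩ := exists_isOptSplit (G := G) two_pos (by omega) _ hf₀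
  obtain ⟨x, w, y, hx, hxw, hxy, hwy, ew, ey⟩ :=
    hz.exists_twins hG le_rfl (by omega) hdeg hlow
  obtain ⟨f, hf⟩ := hcol x
  have hclique := isClique_of_closed_twins hm hG hdeg hlow hx hxw hxy hwy ew ey hf
  have hW : (insert x (G.neighborFinset x)).card = 2 + s + 1 := by
    rw [Finset.card_insert_of_notMem (by simp), card_neighborFinset_eq_degree, hx]
  -- A vertex outside could be deleted, leaving an `m`-colored clique on `m + 1` vertices.
  have huniv : ∀ v, v ∈ insert x (G.neighborFinset x) := by
    intro v
    by_contra hv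
    obtain ⟨g, hg⟩ := hcol v
    have hinj : Set.InjOn g (insert x (G.neighborFinset x) : Finset V) := by
      intro a ha b hb hab
      by_contra hne
      exact hg a b (fun e => hv (e ▸ ha)) (fun e => hv (e ▸ hb)) (hclique a ha b hb hne) hab
    have := Finset.card_le_univ ((insert x (G.neighborFinset x)).image g)
    rw [Finset.card_image_of_injOn hinj, hW, Fintype.card_fin] at this
    omega
  refine ⟨?_, ?_⟩
  · ext u v
    exact ⟨fun h => h.ne, fun h => hclique u (huniv u) v (huniv v) h⟩
  · rw [← hW, ← Finset.card_univ]
    congr 1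
    exact (Finset.eq_univ_of_forall huniv).symm

end SimpleGraph

/-- Among finite graphs `G` with `Δ(G) ≥ 6`, those that are critical with `χ(G) ≥ Δ(G)` and whose
subgraph on the vertices of degree at least `χ(G)` is edgeless are exactly the complete graphs
on `χ(G)` vertices. -/
theorem corollaryN {V : Type*} [Fintype V] (G : SimpleGraph V) [DecidableRel G.Adj]
    (hΔ : 6 ≤ G.maxDegree) :
    (G.IsCritical ∧ (G.maxDegree : ℕ∞) ≤ G.chromaticNumber ∧ G.highSubgraph = ⊥) ↔
      Nonempty (G ≃g SimpleGraph.completeGraph (Fin G.chromaticNumber.toNat)) := by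
  classical
  have hne : Nonempty V := by
    by_contra h
    rw [not_nonempty_iff] at h
    simp at hΔ
  constructor
  · rintro ⟨hcrit, hχ, hhigh⟩
    obtain ⟨n, hn⟩ := ENat.ne_top_iff_exists.1
      (SimpleGraph.chromaticNumber_ne_top_iff_exists.2 ⟨_, G.colorable_of_fintype⟩)
    rw [← hn, Nat.cast_le] at hχ
    obtain ⟨m, rfl⟩ : ∃ m, n = m + 1 := ⟨n - 1, by omega⟩
    obtain ⟨htop, hcard⟩ := SimpleGraph.eq_top_of_critical (G := G) (m := m) (by omega)
      (fun h => by
        have := h.chromaticNumber_le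
        rw [← hn, Nat.cast_le] at this
        omega)
      (fun x => by
        have h := hcrit x
        rw [← hn, Nat.cast_add, Nat.cast_one, ENat.lt_natCast_add_one_iff,
          SimpleGraph.chromaticNumber_le_iff_colorable] at h
        obtain ⟨C⟩ := h
        refine ⟨fun v => if hv : v ∈ ({x}ᶜ : Set V) then C ⟨v, hv⟩ else ⟨0, by omega⟩,
          fun a b ha hb hab => ?_⟩
        have ha' : a ∈ ({x}ᶜ : Set V) := ha
        have hb' : b ∈ ({x}ᶜ : Set V) := hb
        simp only [ha', hb', dif_pos]
        exact C.valid hab)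
      (fun v => (G.degree_le_maxDegree v).trans hχ)
      (fun u v huv => by
        by_contra! h
        have hu : u ∈ G.highVertices := by
          show G.chromaticNumber ≤ _
          rw [← hn, Nat.cast_le]; omega
        have hv : v ∈ G.highVertices := by
          show G.chromaticNumber ≤ _
          rw [← hn, Nat.cast_le]; omega
        have hadj : G.highSubgraph.Adj ⟨u, hu⟩ ⟨v, hv⟩ := huv
        rw [hhigh] at hadj
        exact hadj)
    have hcard' : Fintype.card V = G.chromaticNumber.toNat := by rw [← hn, hcard]; rfl
    exact ⟨⟨Fintype.equivFinOfCardEq hcard', by simp [htop, SimpleGraph.completeGraph]⟩⟩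
  · rintro ⟨e⟩
    have htop : G = ⊤ := by
      ext u v
      rw [← e.map_rel_iff]
      simp [SimpleGraph.completeGraph]
    have hdeg : ∀ v, G.degree v + 1 = Fintype.card V := fun v => by
      have : G.neighborFinset v = Finset.univ.erase v := by
        ext u
        simp [htop, eq_comm]
      rw [← G.card_neighborFinset_eq_degree, this, Finset.card_erase_add_one (Finset.mem_univ v),
        Finset.card_univ]
    have hχ : G.chromaticNumber = Fintype.card V := by
      rw [htop]; exact SimpleGraph.chromaticNumber_top
    refine ⟨fun v => ?_, ?_, ?_⟩
    · refine lt_of_le_of_lt SimpleGraph.chromaticNumber_le_card ?_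
      rw [hχ, Nat.cast_lt]
      exact Fintype.card_subtype_lt (x := v) (by simp)
    · rw [hχ, Nat.cast_le]
      exact SimpleGraph.maxDegree_le_of_forall_degree_le _ _ fun v => by have := hdeg v; omega
    -- Every degree is `|V| - 1`, below the chromatic number, so there are no high vertices at all.
    · ext ⟨u, hu⟩ v
      have hu : G.chromaticNumber ≤ (G.degree u : ℕ∞) := hu
      rw [hχ, Nat.cast_le] at hu
      have := hdeg u
      omega
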